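/- **Definitions.** Let $m\ge 0$ and $n\ge 1$ be integers. A *fundamental set* of type $(2m+1,n,k)$ is a nonempty set $\mathcal E$ of subsets of $\{1,\dots,n\}$, each having $2m+1$ elements, such that exactly $k$ elements of $\{1,\dots,n\}$ are *indispensable*, that is, belong to every member of $\mathcal E$. A subset of $\{1,\dots,n\}$ is *acceptable* if it contains a member of $\mathcal E$. The *associated complex* $\mathcal P$ is the simplicial complex of all subsets of $\{1,\dots,n\}$ whose complement is acceptable. Put $\mathcal S=\{z\in\mathbb C^n : \{i : z_i\neq 0\}\text{ is acceptable}\}$, an open subset of $\mathbb C^n$. Let $l=(l_1,\dots,l_n)$ be a family of vectors of $\mathbb C^m$ such that $(l_p)_{p\in P}$ spans $\mathbb C^m$ as a real affine space for every $P\in\mathcal E$. The group $\mathbb C^*\times\mathbb C^m$ acts on $\mathcal S$ by $$(\alpha,T)\cdot z=\bigl(\alpha e^{\langle l_1,T\rangle}z_1,\dots,\alpha e^{\langle l_n,T\rangle}z_n\bigr),\qquad \langle u,T\rangle=\sum_{a=1}^m u_aT_a .$$ Let $\mathcal N$ be the orbit space, with the quotient topology. The pair $(\mathcal E,l)$ is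 a *good system* if $\mathcal N$ is compact and can be endowed with a structure of (Hausdorff) complex manifold such that the projection $\mathcal S\to\mathcal N$ is holomorphic; $\mathcal N$ is then called an *LVMB manifold*. For a simplicial complex $K$ on a finite set $V$ (a nonempty family of subsets of $V$ closed under taking subsets; elements of $V$ need not be vertices), the *moment-angle complex* is $$\mathcal Z_{K,V}=\bigcup_{\sigma\in K}\bigl\{z\in\mathbb C^V : |z_i|\le 1 \text{ for all } i\in V,\ |z_i|=1 \text{ for all } i\notin\sigma\bigr\},$$ and we write $\mathcal Z_{K,n}$ when $V=\{1,\dots,n\}$. **Proposition.** Let $(\mathcal E,l)$ be a good system of type $(2m+1,n,k)$ with $k>0$. Then there is an indispensable element, and for every indispensable element $j$ the following holds. No face of $\mathcal P$ contains $j$, so $\mathcal P$ may be regarded as a simplicial complex on the $(n-1)$-element set $V_j=\{1,\dots,n\}\setminus\{j\}$. The LVMB manifold $\mathcal N$ is homeomorphic to the moment-angle complex $\mathcal Z_{\mathcal P,V_j}\subset\mathbb C^{V_j}\cong\mathbb C^{n-1}$ (for $j=n$ this is $\mathcal Z_{\mathcal P,n-1}$), by a homeomorphism $\varphi$ that is induced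 by dividing all coordinates by the $j$-th one: for every $z\in\mathcal Z_{\mathcal P,n}\subset\mathcal S$, $$\varphi([z])=\Bigl(\frac{z_i}{z_j}\Bigr)_{i\in V_j}.$$ -/

import Mathlib

open scoped Manifold ContDiff

namespace LVMB

/-- A simplicial complex on the finite set `ι`: a nonempty family of subsets of `ι`, closed under
passing to subsets. The empty set is always a face, and an element of `ι` need not be a vertex. -/
structure SimplicialCpx (ι : Type*) where
  faces : Set (Finset ι)
  empty_mem : ∅ ∈ faces
  down_closed : ∀ σ ∈ faces, ∀ τ : Finset ι, τ ⊆ σ → τ ∈ faces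

/-- The faces of `K` that are contained in `s`, as a simplicial complex on the set `s`. -/
def SimplicialCpx.restrict {ι : Type*} (K : SimplicialCpx ι) (s : Set ι) :
    SimplicialCpx s where
  faces := {τ | τ.map (Function.Embedding.subtype _) ∈ K.faces}
  empty_mem := by simpa using K.empty_mem
  down_closed := fun σ hσ τ hτ => K.down_closed _ hσ _ (Finset.map_subset_map.2 hτ)

/-- `B_σ`: the points of the closed polydisc all of whose coordinates outside `σ` have modulus 1. -/
def polydiscBlock {ι : Type*} (σ : Finset ι) : Set (ι → ℂ) :=
  {z | (∀ i, ‖z i‖ ≤ 1) ∧ ∀ i, i ∉ σ → ‖z i‖ = 1}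

/-- The moment-angle complex of `K`: the union of the `B_σ` over the faces `σ` of `K`. -/
def momentAngleComplex {ι : Type*} (K : SimplicialCpx ι) : Set (ι → ℂ) :=
  ⋃ σ ∈ K.faces, polydiscBlock σ

/-- A fundamental set: a nonempty set of subsets of `ι`, each having `M` elements. -/
structure FundamentalSet (M : ℕ) (ι : Type*) where
  sets : Set (Finset ι)
  nonempty : sets.Nonempty
  card_eq : ∀ P ∈ sets, P.card = M

namespace FundamentalSet

variable {M : ℕ} {ι : Type*}

/-- A subset is acceptable if it contains a fundamental subset. -/
def Acceptable (E : FundamentalSet M ι) (A : Set ι) : Prop :=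
  ∃ P ∈ E.sets, (P : Set ι) ⊆ A

/-- An element is indispensable if it belongs to every fundamental subset. -/
def Indispensable (E : FundamentalSet M ι) (j : ι) : Prop :=
  ∀ P ∈ E.sets, j ∈ P

/-- `E` is of type `(M, n, k)`: it lives on a set with `n` elements, and exactly `k` of these
elements are indispensable. -/
def HasType (E : FundamentalSet M ι) (n k : ℕ) : Prop :=
  Nat.card ι = n ∧ {j | E.Indispensable j}.ncard = k

/-- The associated complex: the subsets whose complement is acceptable. -/
def associatedComplex (E : FundamentalSet M ι) : SimplicialCpx ι where
  faces := {σ | E.Acceptable (σ : Set ι)ᶜ}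
  empty_mem := by
    obtain ⟨P, hP⟩ := E.nonempty
    exact ⟨P, hP, by simp⟩
  down_closed := by
    rintro σ ⟨P, hP, hPσ⟩ τ hτ
    exact ⟨P, hP, hPσ.trans (Set.compl_subset_compl.2 (Finset.coe_subset.2 hτ))⟩

/-- The open set `S` of the points of `ℂ^ι` whose set of nonzero coordinates is acceptable. -/
def openSet [Finite ι] (E : FundamentalSet M ι) : TopologicalSpace.Opens (ι → ℂ) where
  carrier := {z | E.Acceptable {i | z i ≠ 0}}
  is_open' := by
    have h : {z : ι → ℂ | E.Acceptable {i | z i ≠ 0}} =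
        ⋃ P ∈ E.sets, ⋂ i ∈ P, {z : ι → ℂ | z i ≠ 0} := by
      ext z
      simp [Acceptable, Set.subset_def]
    rw [h]
    refine isOpen_biUnion fun P _ => isOpen_biInter_finset fun i _ => ?_
    exact isOpen_ne_fun (continuous_apply i) continuous_const

end FundamentalSet

/-- The acceptable holomorphic action: `(α, T) · z = (α e^{⟨l_i, T⟩} z_i)_i`, where
`⟨l_i, T⟩` is the bilinear (not hermitian) product. -/
noncomputable def act {m : ℕ} {ι : Type*} (l : ι → Fin m → ℂ) (α : ℂˣ) (T : Fin m → ℂ)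
    (z : ι → ℂ) : ι → ℂ :=
  fun i => (α : ℂ) * Complex.exp (∑ a, l i a * T a) * z i

section Quotient

variable {m : ℕ} {ι : Type*} [Finite ι]

/-- The relation "to be in the same orbit of `ℂˣ × ℂ^m`" on `S`. -/
def orbitSetoid (E : FundamentalSet (2 * m + 1) ι) (l : ι → Fin m → ℂ) : Setoid E.openSet where
  r z w := ∃ (α : ℂˣ) (T : Fin m → ℂ), act l α T z.1 = w.1
  iseqv :=
    { refl := fun z => ⟨1, 0, by ext i; simp [act]⟩
      symm := by
        rintro z w ⟨α, T, h⟩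
        refine ⟨α⁻¹, -T, ?_⟩
        rw [← h]
        ext i
        have hα : (α : ℂ) ≠ 0 := α.ne_zero
        simp only [act, Pi.neg_apply, mul_neg, Finset.sum_neg_distrib, Complex.exp_neg,
          Units.val_inv_eq_inv_val]
        field_simp [Complex.exp_ne_zero]
      trans := by
        rintro z w v ⟨α, T, h⟩ ⟨β, U, h'⟩
        refine ⟨β * α, U + T, ?_⟩
        rw [← h', ← h]
        ext i
        simp only [act, Pi.add_apply, mul_add, Finset.sum_add_distrib, Complex.exp_add,
          Units.val_mul]
        ring }

/-- The orbit space `N` of the holomorphic action restricted to `S`. -/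
def OrbitSpace (E : FundamentalSet (2 * m + 1) ι) (l : ι → Fin m → ℂ) : Type _ :=
  Quotient (orbitSetoid E l)

/-- `N` carries the quotient topology. -/
instance (E : FundamentalSet (2 * m + 1) ι) (l : ι → Fin m → ℂ) :
    TopologicalSpace (OrbitSpace E l) :=
  inferInstanceAs (TopologicalSpace (Quotient (orbitSetoid E l)))

/-- The natural projection `S → N`. -/
def proj (E : FundamentalSet (2 * m + 1) ι) (l : ι → Fin m → ℂ) (z : E.openSet) :
    OrbitSpace E l :=
  Quotient.mk (orbitSetoid E l) z

/-- `(E, l)` is an acceptable system: for each fundamental subset `P`, the points `l_p`, `p ∈ P`,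
span `ℂ^m` as a real affine space. -/
def IsAcceptableSystem (E : FundamentalSet (2 * m + 1) ι) (l : ι → Fin m → ℂ) : Prop :=
  ∀ P ∈ E.sets, affineSpan ℝ (l '' (P : Set ι)) = ⊤

end Quotient

/-- `(E, l)` is a good system: it is an acceptable system whose orbit space `N`, with the quotient
topology, is compact and can be endowed with the structure of a (Hausdorff) complex manifold for
which the projection `S → N` is holomorphic. -/
def IsGoodSystem {m : ℕ} {ι : Type*} [Fintype ι] (E : FundamentalSet (2 * m + 1) ι)
    (l : ι → Fin m → ℂ) : Prop :=
  IsAcceptableSystem E l ∧ CompactSpace (OrbitSpace E l) ∧ T2Space (OrbitSpace E l) ∧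
    ∃ (d : ℕ) (_ : ChartedSpace (Fin d → ℂ) (OrbitSpace E l)),
      IsManifold 𝓘(ℂ, Fin d → ℂ) ω (OrbitSpace E l) ∧
      MDifferentiable 𝓘(ℂ, ι → ℂ) 𝓘(ℂ, Fin d → ℂ) (proj E l)

end LVMB

/-! Taking logarithms of moduli, $(\alpha,T)$ adds to the $i$-th coordinate the value at $l_i$ of
the real affine function $u\mapsto \log|\alpha|+\mathrm{Re}\langle u,T\rangle$, so orbits are
controlled by convex geometry of the $l_i$. Compactness of $\mathcal N$ gives an affine function
below any data on the $l_i$, touching it on a member of $\mathcal E$ (`exists_level_le`); hence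
every orbit meets the moment-angle complex. Hausdorffness forbids separating two members of
$\mathcal E$ (`eq_zero_of_level_nonpos_of_level_nonneg`); hence an orbit meets the complex in a
single circle orbit. So $\mathcal N$ is the complex modulo the diagonal circle, and as $|z_j|=1$
there for indispensable $j$, the slice $z_j=1$ meets each circle exactly once. -/

open Filter Topology

namespace LVMB

/-! ### Real affine functions governing the moduli. -/

section Level

variable {m : ℕ} {ι : Type*}

/-- The logarithm of the factor by which `(e^s, T)` rescales the modulus of the `i`-th
coordinate. -/
noncomputable def level (l : ι → Fin m → ℂ) (i : ι) : (ℝ × (Fin m → ℂ)) →ₗ[ℝ] ℝ where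
  toFun v := v.1 + (∑ a, l i a * v.2 a).re
  map_add' v w := by
    simp only [Prod.fst_add, Prod.snd_add, Pi.add_apply, mul_add, Finset.sum_add_distrib,
      Complex.add_re]
    ring
  map_smul' c v := by
    simp only [Prod.smul_fst, Prod.smul_snd, Pi.smul_apply, mul_smul_comm, ← Finset.smul_sum,
      Complex.smul_re, smul_eq_mul, RingHom.id_apply]
    ring

theorem norm_act (l : ι → Fin m → ℂ) (α : ℂˣ) (T : Fin m → ℂ) (z : ι → ℂ) (i : ι) :
    ‖act l α T z i‖ = Real.exp (level l i (Real.log ‖(α : ℂ)‖, T)) * ‖z i‖ := by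
  have hα : 0 < ‖(α : ℂ)‖ := norm_pos_iff.2 α.ne_zero
  simp only [act, norm_mul, Complex.norm_exp, level, LinearMap.coe_mk, AddHom.coe_mk,
    Real.exp_add, Real.exp_log hα]

/-- The positive real number `e^s`, as a unit of `ℂ`. -/
noncomputable def expUnit (s : ℝ) : ℂˣ :=
  Units.mk0 (Real.exp s : ℂ) (by exact_mod_cast (Real.exp_pos s).ne')

theorem norm_act_expUnit (l : ι → Fin m → ℂ) (v : ℝ × (Fin m → ℂ)) (z : ι → ℂ) (i : ι) :
    ‖act l (expUnit v.1) v.2 z i‖ = Real.exp (level l i v) * ‖z i‖ := by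
  have h : Real.log ‖(expUnit v.1 : ℂ)‖ = v.1 := by
    rw [expUnit, Units.val_mk0, Complex.norm_real, Real.norm_eq_abs, Real.abs_exp, Real.log_exp]
  rw [norm_act, h]

theorem act_ne_zero_iff (l : ι → Fin m → ℂ) (α : ℂˣ) (T : Fin m → ℂ) (z : ι → ℂ) (i : ι) :
    act l α T z i ≠ 0 ↔ z i ≠ 0 := by
  simp [act, Complex.exp_ne_zero]

theorem continuous_act (l : ι → Fin m → ℂ) (α : ℂˣ) (T : Fin m → ℂ) :
    Continuous (act l α T) := by
  unfold act
  fun_prop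

theorem eq_zero_of_level_eq_zero {l : ι → Fin m → ℂ} {P : Set ι}
    (hP : affineSpan ℝ (l '' P) = ⊤) {v : ℝ × (Fin m → ℂ)}
    (hv : ∀ i ∈ P, level l i v = 0) : v = 0 := by
  have key : ∀ u : Fin m → ℂ, v.1 + (∑ a, u a * v.2 a).re = 0 := by
    intro u
    have hu : u ∈ affineSpan ℝ (l '' P) := hP ▸ AffineSubspace.mem_top ℝ _ u
    refine affineSpan_induction (p := fun u => v.1 + (∑ a, u a * v.2 a).re = 0) hu ?_ ?_
    · rintro _ ⟨i, hi, rfl⟩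
      exact hv i hi
    · intro c x y z hx hy hz
      have h : (∑ a, (c • (x -ᵥ y) +ᵥ z) a * v.2 a) =
          c • ((∑ a, x a * v.2 a) - ∑ a, y a * v.2 a) + ∑ a, z a * v.2 a := by
        simp only [vsub_eq_sub, vadd_eq_add, Pi.add_apply, Pi.smul_apply, Pi.sub_apply, add_mul,
          smul_mul_assoc, sub_mul, Finset.sum_add_distrib, ← Finset.smul_sum,
          Finset.sum_sub_distrib]
      rw [h, Complex.add_re, Complex.smul_re, Complex.sub_re, smul_eq_mul]
      linear_combination c * hx - c * hy + hz
  have h0 : v.1 = 0 := by simpa using key 0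
  -- At the conjugate of $T$, the linear part equals $\sum_a|T_a|^2$.
  have h1 := key (fun a => (starRingEnd ℂ) (v.2 a))
  rw [h0, zero_add, Complex.re_sum] at h1
  have h2 : ∀ a, ((starRingEnd ℂ) (v.2 a) * v.2 a).re = Complex.normSq (v.2 a) := fun a => by
    rw [mul_comm, Complex.mul_conj, Complex.ofReal_re]
  simp only [h2] at h1
  rw [Finset.sum_eq_zero_iff_of_nonneg fun a _ => Complex.normSq_nonneg _] at h1
  exact Prod.ext h0 (funext fun a => Complex.normSq_eq_zero.1 (h1 a (Finset.mem_univ a)))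

/-- The levels at the elements of a fundamental subset are linear coordinates. -/
noncomputable def levelEquiv (l : ι → Fin m → ℂ) (P : Finset ι) (hc : P.card = 2 * m + 1)
    (hP : affineSpan ℝ (l '' (P : Set ι)) = ⊤) : (ℝ × (Fin m → ℂ)) ≃ₗ[ℝ] (P → ℝ) :=
  LinearEquiv.ofInjectiveOfFinrankEq (LinearMap.pi fun i : P => level l i)
    (by
      rw [← LinearMap.ker_eq_bot, LinearMap.ker_eq_bot']
      exact fun v hv => eq_zero_of_level_eq_zero hP fun i hi => congrFun hv ⟨i, hi⟩)
    -- Both sides have real dimension $2m+1$.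
    (by
      rw [Module.finrank_prod, Module.finrank_pi_fintype, Module.finrank_fintype_fun_eq_card]
      simp [hc, Complex.finrank_real_complex]
      ring)

end Level

/-! ### Combinatorics and compactness of the moment-angle complex. -/

theorem FundamentalSet.Acceptable.mono {M : ℕ} {ι : Type*} {E : FundamentalSet M ι}
    {A B : Set ι} (hA : E.Acceptable A) (hAB : A ⊆ B) : E.Acceptable B :=
  let ⟨P, hP, hPA⟩ := hA
  ⟨P, hP, hPA.trans hAB⟩

theorem FundamentalSet.Indispensable.notMem {M : ℕ} {ι : Type*} {E : FundamentalSet M ι} {j : ι}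
    (hj : E.Indispensable j) {σ : Finset ι} (hσ : σ ∈ E.associatedComplex.faces) : j ∉ σ := by
  obtain ⟨P, hP, hPσ⟩ := hσ
  exact fun h => hPσ (hj P hP) h

theorem exists_norm_eq_one_of_mem_momentAngleComplex {M : ℕ} {ι : Type*}
    {E : FundamentalSet M ι} {z : ι → ℂ} (hz : z ∈ momentAngleComplex E.associatedComplex) :
    (∀ i, ‖z i‖ ≤ 1) ∧ ∃ P ∈ E.sets, ∀ i ∈ P, ‖z i‖ = 1 := by
  simp only [momentAngleComplex, Set.mem_iUnion] at hz
  obtain ⟨σ, ⟨P, hP, hPσ⟩, h1, h2⟩ := hz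
  exact ⟨h1, P, hP, fun i hi => h2 i fun h => hPσ hi h⟩

theorem mem_momentAngleComplex_of_norm_eq_one {M : ℕ} {ι : Type*} [Finite ι]
    {E : FundamentalSet M ι} {z : ι → ℂ} (h1 : ∀ i, ‖z i‖ ≤ 1) {P : Finset ι} (hP : P ∈ E.sets)
    (h2 : ∀ i ∈ P, ‖z i‖ = 1) : z ∈ momentAngleComplex E.associatedComplex := by
  classical
  have := Fintype.ofFinite ι
  simp only [momentAngleComplex, Set.mem_iUnion]
  exact ⟨Pᶜ, ⟨P, hP, by simp⟩, h1, fun i hi => h2 i (by simpa using hi)⟩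

theorem momentAngleComplex_subset_openSet {M : ℕ} {ι : Type*} [Finite ι]
    {E : FundamentalSet M ι} {z : ι → ℂ} (hz : z ∈ momentAngleComplex E.associatedComplex) :
    z ∈ E.openSet := by
  obtain ⟨-, P, hP, h⟩ := exists_norm_eq_one_of_mem_momentAngleComplex hz
  exact ⟨P, hP, fun i hi => norm_pos_iff.1 (by rw [h i hi]; exact one_pos)⟩

theorem isCompact_momentAngleComplex {ι : Type*} [Finite ι] (K : SimplicialCpx ι) :
    IsCompact (momentAngleComplex K) := by
  refine K.faces.toFinite.isCompact_biUnion fun σ _ => ?_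
  refine (isCompact_univ_pi fun _ : ι => isCompact_closedBall (0 : ℂ) 1).of_isClosed_subset ?_
    fun z hz i _ => by simpa using hz.1 i
  simp only [polydiscBlock, Set.ofPred_and, Set.ofPred_forall]
  refine (isClosed_iInter fun i => isClosed_le (by fun_prop) continuous_const).inter
    (isClosed_iInter fun i => isClosed_iInter fun _ => isClosed_eq (by fun_prop) continuous_const)

/-! ### Orbits and the moment-angle complex. -/

section Quotient

variable {m : ℕ} {ι : Type*} [Finite ι] {E : FundamentalSet (2 * m + 1) ι} {l : ι → Fin m → ℂ}

theorem proj_eq_proj {z w : E.openSet} :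
    proj E l z = proj E l w ↔ ∃ (α : ℂˣ) (T : Fin m → ℂ), act l α T z.1 = w.1 :=
  Quotient.eq (r := orbitSetoid E l)

theorem continuous_proj : Continuous (proj E l) :=
  continuous_quotient_mk'

theorem proj_surjective : Function.Surjective (proj E l) :=
  Quotient.mk_surjective

theorem act_mem_openSet (α : ℂˣ) (T : Fin m → ℂ) {z : ι → ℂ} (hz : z ∈ E.openSet) :
    act l α T z ∈ E.openSet :=
  FundamentalSet.Acceptable.mono hz fun i hi => (act_ne_zero_iff l α T z i).2 hi

/-- The saturation of an open set is a union of its translates. This lets convergence in the orbit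
space be lifted to nearby representatives. -/
theorem isOpenMap_proj : IsOpenMap (proj E l) := by
  intro U hU
  have h : proj E l ⁻¹' (proj E l '' U) = ⋃ (α : ℂˣ) (T : Fin m → ℂ),
      (fun z : E.openSet => (⟨act l α T z.1, act_mem_openSet α T z.2⟩ : E.openSet)) ⁻¹' U := by
    ext z
    simp only [Set.mem_preimage, Set.mem_image, Set.mem_iUnion]
    constructor
    · rintro ⟨w, hw, hwz⟩
      obtain ⟨α, T, h⟩ := proj_eq_proj.1 hwz.symm
      exact ⟨α, T, by simpa only [h] using hw⟩
    · rintro ⟨α, T, h⟩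
      exact ⟨_, h, (proj_eq_proj.2 ⟨α, T, rfl⟩).symm⟩
  refine isOpen_coinduced.2 (show IsOpen (proj E l ⁻¹' (proj E l '' U)) from ?_)
  rw [h]
  exact isOpen_iUnion fun α => isOpen_iUnion fun T => hU.preimage
    (((continuous_act l α T).comp continuous_subtype_val).subtype_mk _)

/-- If the orbit space is Hausdorff, no nonzero affine function separates the vectors of two
fundamental subsets. -/
theorem eq_zero_of_level_nonpos_of_level_nonneg [T2Space (OrbitSpace E l)]
    (hl : IsAcceptableSystem E l) {P Q : Finset ι} (hP : P ∈ E.sets) (hQ : Q ∈ E.sets)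
    {v : ℝ × (Fin m → ℂ)} (hvP : ∀ i ∈ P, level l i v ≤ 0) (hvQ : ∀ i ∈ Q, 0 ≤ level l i v) :
    v = 0 := by
  classical
  by_contra hv
  obtain ⟨p, hp, hpv⟩ : ∃ p ∈ P, level l p v < 0 := by
    by_contra! h
    exact hv (eq_zero_of_level_eq_zero (hl P hP) fun i hi => le_antisymm (hvP i hi) (h i hi))
  -- `x k` is 1 on $P$, and flowing by $kv$ gives `y k`, of modulus 1 on $Q$. Both stay in the
  -- closed polydisc, so they have limits in $\mathcal S$; these share an orbit by Hausdorffness,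
  -- yet only the second vanishes at `p`.
  let x : ℕ → ι → ℂ := fun k i =>
    if i ∈ P then 1 else if i ∈ Q then (Real.exp (-(k * level l i v)) : ℂ) else 0
  let y : ℕ → ι → ℂ := fun k => act l (expUnit ((k : ℝ) • v).1) ((k : ℝ) • v).2 (x k)
  have hxP : ∀ k, ∀ i ∈ P, x k i = 1 := fun k i hi => if_pos hi
  have hxS : ∀ k, x k ∈ E.openSet := fun k =>
    ⟨P, hP, fun i hi => by simp [hxP k i hi]⟩
  have hy : ∀ k i, ‖y k i‖ = Real.exp (k * level l i v) * ‖x k i‖ := fun k i => by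
    rw [norm_act_expUnit, map_smul, smul_eq_mul]
  have hx1 : ∀ k i, ‖x k i‖ ≤ 1 := fun k i => by
    simp only [x]
    split_ifs with h1 h2
    · simp
    · rw [Complex.norm_real, Real.norm_eq_abs, Real.abs_exp, Real.exp_le_one_iff, neg_nonpos]
      exact mul_nonneg k.cast_nonneg (hvQ i h2)
    · simp
  have hyQ : ∀ k, ∀ i ∈ Q, ‖y k i‖ = 1 := fun k i hi => by
    rw [hy]
    by_cases h : i ∈ P
    · rw [hxP k i h, le_antisymm (hvP i h) (hvQ i hi)]
      simp
    · simp only [x, if_neg h, if_pos hi]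
      rw [Complex.norm_real, Real.norm_eq_abs, Real.abs_exp, ← Real.exp_add, add_neg_cancel,
        Real.exp_zero]
  have hy1 : ∀ k i, ‖y k i‖ ≤ 1 := fun k i => by
    by_cases hQi : i ∈ Q
    · exact (hyQ k i hQi).le
    rw [hy]
    by_cases h : i ∈ P
    · rw [hxP k i h, norm_one, mul_one, Real.exp_le_one_iff]
      exact mul_nonpos_of_nonneg_of_nonpos k.cast_nonneg (hvP i h)
    · simp [x, h, hQi]
  have hyp : Tendsto (fun k => ‖y k p‖) atTop (𝓝 0) := by
    have : (fun k => ‖y k p‖) = fun k : ℕ => Real.exp ((k : ℝ) * level l p v) := by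
      funext k
      rw [hy, hxP k p hp, norm_one, mul_one]
    rw [this]
    exact Real.tendsto_exp_atBot.comp (tendsto_natCast_atTop_atTop.atTop_mul_const_of_neg hpv)
  -- A single ultrafilter replaces successive extraction of subsequences.
  have hle : (hyperfilter ℕ : Filter ℕ) ≤ atTop := Nat.hyperfilter_le_atTop
  have hcpt : IsCompact (Set.univ.pi fun _ : ι => Metric.closedBall (0 : ℂ) 1) :=
    isCompact_univ_pi fun _ => isCompact_closedBall _ _
  obtain ⟨a, -, ha⟩ := hcpt.ultrafilter_le_nhds ((hyperfilter ℕ).map x)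
    (by
      rw [le_principal_iff]
      exact mem_map.2 (Filter.univ_mem' fun k i _ => by simpa using hx1 k i))
  obtain ⟨b, -, hb⟩ := hcpt.ultrafilter_le_nhds ((hyperfilter ℕ).map y)
    (by
      rw [le_principal_iff]
      exact mem_map.2 (Filter.univ_mem' fun k i _ => by simpa using hy1 k i))
  have ha' : Tendsto x (hyperfilter ℕ) (𝓝 a) := ha
  have hb' : Tendsto y (hyperfilter ℕ) (𝓝 b) := hb
  have haP : ∀ i ∈ P, a i = 1 := fun i hi => by
    refine tendsto_nhds_unique (tendsto_pi_nhds.1 ha' i) ?_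
    simp only [hxP _ i hi]
    exact tendsto_const_nhds
  have hbQ : ∀ i ∈ Q, ‖b i‖ = 1 := fun i hi => by
    refine tendsto_nhds_unique (tendsto_pi_nhds.1 hb' i).norm ?_
    simp only [hyQ _ i hi]
    exact tendsto_const_nhds
  have hbp : b p = 0 := norm_eq_zero.1
    (tendsto_nhds_unique (tendsto_pi_nhds.1 hb' p).norm (hyp.mono_left hle))
  have haS : a ∈ E.openSet := ⟨P, hP, fun i hi => by simp [haP i hi]⟩
  have hbS : b ∈ E.openSet :=
    ⟨Q, hQ, fun i hi => norm_pos_iff.1 (by rw [hbQ i hi]; exact one_pos)⟩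
  let X : ℕ → E.openSet := fun k => ⟨x k, hxS k⟩
  let Y : ℕ → E.openSet := fun k => ⟨y k, act_mem_openSet _ _ (hxS k)⟩
  have hX : Tendsto X (hyperfilter ℕ) (𝓝 ⟨a, haS⟩) := tendsto_subtype_rng.2 ha'
  have hY : Tendsto Y (hyperfilter ℕ) (𝓝 ⟨b, hbS⟩) := tendsto_subtype_rng.2 hb'
  have hXY : proj E l ∘ X = proj E l ∘ Y := funext fun k => proj_eq_proj.2 ⟨_, _, rfl⟩
  have h1 := (continuous_proj (E := E) (l := l)).continuousAt.tendsto.comp hX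
  have h2 := (continuous_proj (E := E) (l := l)).continuousAt.tendsto.comp hY
  rw [← hXY] at h2
  obtain ⟨α, T, h⟩ := proj_eq_proj.1 (tendsto_nhds_unique h1 h2)
  refine (act_ne_zero_iff l α T a p).2 (by simp [haP p hp]) ?_
  rw [show act l α T a = b from h, hbp]

/-- If the orbit space is compact, every function on `ι` is bounded below by an affine function
which agrees with it on a fundamental subset. -/
theorem exists_level_le [CompactSpace (OrbitSpace E l)] (hl : IsAcceptableSystem E l)
    (x : ι → ℝ) : ∃ v, ∃ P ∈ E.sets, (∀ i, level l i v ≤ x i) ∧ ∀ i ∈ P, level l i v = x i := by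
  have hne : ∀ (k : ℕ) i, (Real.exp (-(k * x i)) : ℂ) ≠ 0 := fun k i => by
    exact_mod_cast (Real.exp_pos _).ne'
  -- A ray in logarithmic coordinates: its classes accumulate at some $[p]$, so representatives near
  -- $p$ bound `level l i v - k * x i` above for all $i$, and below on $P$. Dividing by $k$ removes
  -- the error.
  let z : ℕ → E.openSet := fun k => ⟨fun i => (Real.exp (-(k * x i)) : ℂ), by
    obtain ⟨P, hP⟩ := E.nonempty
    exact ⟨P, hP, fun i _ => hne k i⟩⟩
  have hz : ∀ k i, ‖(z k).1 i‖ = Real.exp (-(k * x i)) := fun k i => by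
    simp only [z]
    rw [Complex.norm_real, Real.norm_eq_abs, Real.abs_exp]
  obtain ⟨q, -, hq⟩ := isCompact_univ.ultrafilter_le_nhds
    ((hyperfilter ℕ).map fun k => proj E l (z k)) (by simp)
  obtain ⟨p, rfl⟩ := proj_surjective q
  obtain ⟨P, hP, hPp⟩ := p.2
  let V : Set E.openSet :=
    {w | (∀ i, ‖w.1 i‖ < ‖p.1 i‖ + 1) ∧ ∀ i ∈ P, ‖p.1 i‖ / 2 < ‖w.1 i‖}
  have hV : V ∈ 𝓝 p := by
    have hc : ∀ i, Tendsto (fun w : E.openSet => ‖w.1 i‖) (𝓝 p) (𝓝 ‖p.1 i‖) := fun i =>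
      (((continuous_apply i).comp continuous_subtype_val).norm).tendsto p
    refine (eventually_all.2 fun i => (hc i).eventually_lt_const (lt_add_one _)).and ?_
    refine (Finset.eventually_all P).2 fun i hi => (hc i).eventually_const_lt (half_lt_self ?_)
    exact norm_pos_iff.2 (hPp hi)
  have hev : ∀ᶠ k : ℕ in (hyperfilter ℕ : Filter ℕ), ∃ v : ℝ × (Fin m → ℂ),
      (∀ i, level l i v - k * x i ≤ Real.log (‖p.1 i‖ + 1)) ∧
        ∀ i ∈ P, Real.log (‖p.1 i‖ / 2) ≤ level l i v - k * x i := by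
    filter_upwards [hq (isOpenMap_proj.image_mem_nhds hV)] with k hk
    obtain ⟨w, ⟨hw1, hw2⟩, hw⟩ := hk
    obtain ⟨α, T, h⟩ := proj_eq_proj.1 hw.symm
    refine ⟨(Real.log ‖(α : ℂ)‖, T), ?_⟩
    have hn : ∀ i, ‖w.1 i‖ = Real.exp (level l i (Real.log ‖(α : ℂ)‖, T) - k * x i) := fun i => by
      rw [← h, norm_act, hz, ← Real.exp_add, sub_eq_add_neg]
    refine ⟨fun i => ?_, fun i hi => ?_⟩
    · rw [Real.le_log_iff_exp_le (by positivity), ← hn]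
      exact (hw1 i).le
    · have : 0 < ‖p.1 i‖ := norm_pos_iff.2 (hPp hi)
      rw [Real.log_le_iff_le_exp (by positivity), ← hn]
      exact (hw2 i hi).le
  obtain ⟨v, hv⟩ := hev.choice
  have hle : (hyperfilter ℕ : Filter ℕ) ≤ atTop := Nat.hyperfilter_le_atTop
  have hpos : ∀ᶠ k : ℕ in (hyperfilter ℕ : Filter ℕ), (0 : ℝ) < k :=
    hle ((eventually_gt_atTop 0).mono fun k hk => Nat.cast_pos.2 hk)
  have hlim : ∀ c d : ℝ, Tendsto (fun k : ℕ => c / k + d) (hyperfilter ℕ) (𝓝 d) := fun c d => by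
    simpa using ((tendsto_const_div_atTop_nhds_zero_nat c).mono_left hle).add_const d
  have hub : ∀ᶠ k : ℕ in (hyperfilter ℕ : Filter ℕ), ∀ i,
      level l i ((k : ℝ)⁻¹ • v k) ≤ Real.log (‖p.1 i‖ + 1) / k + x i := by
    filter_upwards [hv, hpos] with k hk hk0 i
    rw [map_smul, smul_eq_mul, inv_mul_le_iff₀ hk0, mul_add, mul_div_cancel₀ _ hk0.ne']
    linarith [hk.1 i]
  have hlb : ∀ᶠ k : ℕ in (hyperfilter ℕ : Filter ℕ), ∀ i ∈ P,
      Real.log (‖p.1 i‖ / 2) / k + x i ≤ level l i ((k : ℝ)⁻¹ • v k) := by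
    filter_upwards [hv, hpos] with k hk hk0 i hi
    rw [map_smul, smul_eq_mul, le_inv_mul_iff₀ hk0, mul_add, mul_div_cancel₀ _ hk0.ne']
    linarith [hk.2 i hi]
  -- Levels on $P$ are coordinates, so their convergence forces convergence of the rescaled affine
  -- functions.
  let e := levelEquiv l P (E.card_eq P hP) (hl P hP)
  have he : Tendsto (fun k : ℕ => e ((k : ℝ)⁻¹ • v k)) (hyperfilter ℕ)
      (𝓝 fun i : P => x i) := by
    refine tendsto_pi_nhds.2 fun i => ?_
    exact tendsto_of_tendsto_of_tendsto_of_le_of_le' (hlim _ _) (hlim _ _)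
      (hlb.mono fun k hk => hk i i.2) (hub.mono fun k hk => hk i)
  have hsymm : Tendsto (fun k : ℕ => (k : ℝ)⁻¹ • v k) (hyperfilter ℕ)
      (𝓝 (e.symm fun i : P => x i)) := by
    have hcont : Continuous e.symm := e.symm.toLinearMap.continuous_of_finiteDimensional
    refine ((hcont.tendsto _).comp he).congr fun k => ?_
    exact e.symm_apply_apply _
  refine ⟨e.symm fun i : P => x i, P, hP, fun i => ?_, fun i hi => ?_⟩
  · have hcont : Continuous (level l i) := (level l i).continuous_of_finiteDimensional
    exact le_of_tendsto_of_tendsto ((hcont.tendsto _).comp hsymm) (hlim _ _)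
      (hub.mono fun k hk => hk i)
  · exact congrFun (e.apply_symm_apply fun i : P => x i) ⟨i, hi⟩

/-- Every orbit in `S` meets the moment-angle complex. -/
theorem exists_mem_momentAngleComplex [CompactSpace (OrbitSpace E l)]
    [T2Space (OrbitSpace E l)] (hl : IsAcceptableSystem E l) (q : OrbitSpace E l) :
    ∃ z : E.openSet, z.1 ∈ momentAngleComplex E.associatedComplex ∧ proj E l z = q := by
  classical
  let A : Set E.openSet := {z | z.1 ∈ momentAngleComplex E.associatedComplex}
  have hA : IsCompact A := by
    refine Subtype.isCompact_iff.2 ?_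
    rw [show Subtype.val '' A = momentAngleComplex E.associatedComplex from ?_]
    · exact isCompact_momentAngleComplex _
    · ext z
      exact ⟨fun ⟨w, hw, h⟩ => h ▸ hw, fun h => ⟨⟨z, momentAngleComplex_subset_openSet h⟩, h, rfl⟩⟩
  -- It thus suffices to treat the dense set of points with no zero coordinate, where logarithms
  -- exist.
  have hclosed : IsClosed (proj E l ⁻¹' (proj E l '' A)) :=
    (hA.image continuous_proj).isClosed.preimage continuous_proj
  have hnz : ∀ z : E.openSet, (∀ i, z.1 i ≠ 0) → z ∈ proj E l ⁻¹' (proj E l '' A) := by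
    intro z hz
    obtain ⟨v, P, hP, h1, h2⟩ := exists_level_le hl fun i => -Real.log ‖z.1 i‖
    have hn : ∀ i, ‖act l (expUnit v.1) v.2 z.1 i‖ =
        Real.exp (level l i v + Real.log ‖z.1 i‖) := fun i => by
      rw [norm_act_expUnit, Real.exp_add, Real.exp_log (norm_pos_iff.2 (hz i))]
    refine ⟨⟨act l (expUnit v.1) v.2 z.1, act_mem_openSet _ _ z.2⟩, ?_,
      (proj_eq_proj.2 ⟨_, _, rfl⟩).symm⟩
    refine mem_momentAngleComplex_of_norm_eq_one (fun i => ?_) hP fun i hi => ?_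
    · rw [hn, Real.exp_le_one_iff]
      linarith [h1 i]
    · rw [hn, h2 i hi, neg_add_cancel, Real.exp_zero]
  obtain ⟨z, rfl⟩ := proj_surjective q
  let w : ℕ → ι → ℂ := fun k i => if z.1 i = 0 then ((k : ℂ) + 1)⁻¹ else z.1 i
  have hw0 : ∀ k i, w k i ≠ 0 := fun k i => by
    simp only [w]
    split_ifs with h
    · exact inv_ne_zero (Nat.cast_add_one_ne_zero k)
    · exact h
  have hw : Tendsto w atTop (𝓝 z.1) := by
    refine tendsto_pi_nhds.2 fun i => ?_
    simp only [w]
    split_ifs with h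
    · rw [h]
      simpa [one_div] using tendsto_one_div_add_atTop_nhds_zero_nat (𝕜 := ℂ)
    · exact tendsto_const_nhds
  have hmem : z ∈ proj E l ⁻¹' (proj E l '' A) :=
    hclosed.mem_of_tendsto (b := atTop) (f := fun k => (⟨w k, by
      obtain ⟨P, hP⟩ := E.nonempty
      exact ⟨P, hP, fun i _ => hw0 k i⟩⟩ : E.openSet))
      (tendsto_subtype_rng.2 hw) (Eventually.of_forall fun k => hnz _ (hw0 k))
  exact hmem

/-- Two points of the moment-angle complex are in the same orbit only if one is obtained from the
other by multiplication by a unit complex number. -/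
theorem act_eq_smul_of_mem_momentAngleComplex [T2Space (OrbitSpace E l)]
    (hl : IsAcceptableSystem E l) {z : ι → ℂ} {α : ℂˣ} {T : Fin m → ℂ}
    (hz : z ∈ momentAngleComplex E.associatedComplex)
    (hw : act l α T z ∈ momentAngleComplex E.associatedComplex) :
    act l α T z = (α : ℂ) • z := by
  obtain ⟨hz1, P, hP, hzP⟩ := exists_norm_eq_one_of_mem_momentAngleComplex hz
  obtain ⟨hw1, Q, hQ, hwQ⟩ := exists_norm_eq_one_of_mem_momentAngleComplex hw
  -- On $P$ moduli start at 1 and cannot grow; on $Q$ they end at 1 and cannot have shrunk.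
  have h := eq_zero_of_level_nonpos_of_level_nonneg (l := l) hl hP hQ
    (v := (Real.log ‖(α : ℂ)‖, T))
    (fun i hi => by
      have := hw1 i
      rwa [norm_act, hzP i hi, mul_one, Real.exp_le_one_iff] at this)
    (fun i hi => by
      have h := hwQ i hi
      rw [norm_act] at h
      rw [← Real.one_le_exp_iff, ← h]
      exact mul_le_of_le_one_right (Real.exp_pos _).le (hz1 i))
  have hT : T = 0 := congrArg Prod.snd h
  ext i
  simp [act, hT]

end Quotient

/-! ### The slice on which the $j$-th coordinate is 1. -/

section Extend

variable {ι : Type*}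

open Classical in
/-- Extend a family indexed by the complement of `j` by the value `1` at `j`. -/
noncomputable def extendOne (j : ι) (w : {i | i ≠ j} → ℂ) (i : ι) : ℂ :=
  if h : i ≠ j then w ⟨i, h⟩ else 1

theorem extendOne_coe {j : ι} (w : {i | i ≠ j} → ℂ) (i : {i | i ≠ j}) :
    extendOne j w i = w i :=
  dif_pos i.2

theorem extendOne_self (j : ι) (w : {i | i ≠ j} → ℂ) : extendOne j w j = 1 :=
  dif_neg (by simp)

theorem continuous_extendOne (j : ι) : Continuous (extendOne j) := by
  refine continuous_pi fun i => ?_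
  unfold extendOne
  split_ifs
  · exact continuous_apply _
  · exact continuous_const

theorem extendOne_mem_momentAngleComplex {K : SimplicialCpx ι} {j : ι} {w : {i | i ≠ j} → ℂ}
    (hw : w ∈ momentAngleComplex (K.restrict {i | i ≠ j})) :
    extendOne j w ∈ momentAngleComplex K := by
  simp only [momentAngleComplex, Set.mem_iUnion] at hw ⊢
  obtain ⟨τ, hτ, h1, h2⟩ := hw
  refine ⟨_, hτ, fun i => ?_, fun i hi => ?_⟩
  · by_cases h : i = j
    · rw [h, extendOne_self, norm_one]
    · exact (extendOne_coe w ⟨i, h⟩).symm ▸ h1 _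
  · by_cases h : i = j
    · rw [h, extendOne_self, norm_one]
    · refine (extendOne_coe w ⟨i, h⟩).symm ▸ h2 _ fun hτi => hi ?_
      exact Finset.mem_map.2 ⟨_, hτi, rfl⟩

theorem norm_eq_one_of_mem_momentAngleComplex {K : SimplicialCpx ι} {j : ι}
    (hj : ∀ σ ∈ K.faces, j ∉ σ) {z : ι → ℂ} (hz : z ∈ momentAngleComplex K) : ‖z j‖ = 1 := by
  simp only [momentAngleComplex, Set.mem_iUnion] at hz
  obtain ⟨σ, hσ, -, h⟩ := hz
  exact h j (hj σ hσ)

theorem div_mem_momentAngleComplex_restrict {K : SimplicialCpx ι} {j : ι}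
    (hj : ∀ σ ∈ K.faces, j ∉ σ) {z : ι → ℂ} (hz : z ∈ momentAngleComplex K) :
    (fun i : {i | i ≠ j} => z i / z j) ∈ momentAngleComplex (K.restrict {i | i ≠ j}) := by
  classical
  have hzj := norm_eq_one_of_mem_momentAngleComplex hj hz
  simp only [momentAngleComplex, Set.mem_iUnion] at hz ⊢
  obtain ⟨σ, hσ, h1, h2⟩ := hz
  refine ⟨σ.subtype (· ≠ j), K.down_closed σ hσ _ ?_, fun i => ?_, fun i hi => ?_⟩
  · intro i hi
    obtain ⟨a, ha, rfl⟩ := Finset.mem_map.1 hi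
    exact Finset.mem_subtype.1 ha
  · rw [norm_div, hzj, div_one]
    exact h1 i
  · rw [norm_div, hzj, div_one]
    exact h2 i fun h => hi (Finset.mem_subtype.2 h)

end Extend

/-! ### The homeomorphism. -/

section Homeomorph

variable {m : ℕ} {ι : Type*} [Finite ι] {E : FundamentalSet (2 * m + 1) ι} {l : ι → Fin m → ℂ}

/-- The map to the orbit space induced by setting the `j`-th coordinate to `1`. -/
noncomputable def projExtendOne (E : FundamentalSet (2 * m + 1) ι) (l : ι → Fin m → ℂ) (j : ι)
    (w : momentAngleComplex (E.associatedComplex.restrict {i | i ≠ j})) : OrbitSpace E l :=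
  proj E l ⟨extendOne j w.1,
    momentAngleComplex_subset_openSet (extendOne_mem_momentAngleComplex w.2)⟩

theorem continuous_projExtendOne (j : ι) : Continuous (projExtendOne E l j) :=
  continuous_proj.comp (((continuous_extendOne j).comp continuous_subtype_val).subtype_mk _)

theorem projExtendOne_injective [T2Space (OrbitSpace E l)] (hl : IsAcceptableSystem E l) (j : ι) :
    Function.Injective (projExtendOne E l j) := by
  intro w w' h
  obtain ⟨α, T, h⟩ := proj_eq_proj.1 h
  have h' : act l α T (extendOne j w.1) = extendOne j w'.1 := h
  have hs := act_eq_smul_of_mem_momentAngleComplex hl (α := α) (T := T)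
    (extendOne_mem_momentAngleComplex w.2) (h' ▸ extendOne_mem_momentAngleComplex w'.2)
  rw [h'] at hs
  have hα : (1 : ℂ) = α := by
    simpa [extendOne_self] using congrFun hs j
  rw [← hα, one_smul] at hs
  refine Subtype.ext (funext fun i => ?_)
  rw [← extendOne_coe w.1, ← extendOne_coe w'.1, hs]

/-- Multiplying by $z_j$, with $T=0$, undoes the division. This yields both surjectivity and the
formula for $\varphi$. -/
theorem projExtendOne_div {j : ι} (hj : E.Indispensable j) (z : E.openSet)
    (hz : z.1 ∈ momentAngleComplex E.associatedComplex) :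
    projExtendOne E l j ⟨_, div_mem_momentAngleComplex_restrict (fun _ => hj.notMem) hz⟩ =
      proj E l z := by
  have hzj : z.1 j ≠ 0 := norm_pos_iff.1 (by
    rw [norm_eq_one_of_mem_momentAngleComplex (fun _ => hj.notMem) hz]
    exact one_pos)
  refine proj_eq_proj.2 ⟨Units.mk0 (z.1 j) hzj, 0, funext fun i => ?_⟩
  by_cases h : i = j
  · subst h
    simp [act, extendOne_self]
  · have := extendOne_coe (fun i : {i | i ≠ j} => z.1 i / z.1 j) ⟨i, h⟩
    simp only [act, Units.val_mk0, Pi.zero_apply, mul_zero, Finset.sum_const_zero,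
      Complex.exp_zero, mul_one]
    rw [this, mul_div_cancel₀ _ hzj]

theorem projExtendOne_surjective [CompactSpace (OrbitSpace E l)] [T2Space (OrbitSpace E l)]
    (hl : IsAcceptableSystem E l) {j : ι} (hj : E.Indispensable j) :
    Function.Surjective (projExtendOne E l j) := by
  intro q
  obtain ⟨z, hz, rfl⟩ := exists_mem_momentAngleComplex hl q
  exact ⟨_, projExtendOne_div hj z hz⟩

end Homeomorph

end LVMB

theorem mainTheorem4 (m n k : ℕ) (E : LVMB.FundamentalSet (2 * m + 1) (Fin n))
    (l : Fin n → Fin m → ℂ) (hgood : LVMB.IsGoodSystem E l) (htype : E.HasType n k)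
    (hk : 0 < k) :
    (∃ j, E.Indispensable j) ∧
    ∀ j, E.Indispensable j →
      ∃ φ : LVMB.OrbitSpace E l ≃ₜ
          LVMB.momentAngleComplex (E.associatedComplex.restrict {i | i ≠ j}),
        ∀ z : E.openSet, z.1 ∈ LVMB.momentAngleComplex E.associatedComplex →
          ∀ i : {i | i ≠ j}, (φ (LVMB.proj E l z)).1 i = z.1 i / z.1 j := by
  obtain ⟨hl, _, _, -⟩ := hgood
  refine ⟨Set.nonempty_of_ncard_ne_zero (htype.2.trans_ne hk.ne'), fun j hj => ?_⟩
  have := isCompact_iff_compactSpace.1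
    (LVMB.isCompact_momentAngleComplex (E.associatedComplex.restrict {i | i ≠ j}))
  let ψ := Equiv.ofBijective (LVMB.projExtendOne E l j)
    ⟨LVMB.projExtendOne_injective hl j, LVMB.projExtendOne_surjective hl hj⟩
  -- A continuous bijection from a compact space to a Hausdorff one; $\varphi$ is its inverse.
  let Ψ := Continuous.homeoOfEquivCompactToT2 (f := ψ) (LVMB.continuous_projExtendOne j)
  refine ⟨Ψ.symm, fun z hz i => ?_⟩
  have h : Ψ.symm (LVMB.proj E l z) = _ :=
    Ψ.symm_apply_eq.2 (LVMB.projExtendOne_div hj z hz).symm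
  rw [h]
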